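/- Let $X$ be a paracompact Hausdorff space, $Y$ a metric space and $f:X\to Y$ a map. A subset of $X$ is functionally closed if it equals $g^{-1}(0)$ for some continuous $g:X\to\mathbb R$, and functionally open if its complement is functionally closed. Assume that $f$ is functionally fragmented, that is, for every $\varepsilon>0$ there are an ordinal $\alpha$ and functionally open sets $U_\xi\subseteq X$, $\xi\in[0,\alpha]$, such that $U_0=\emptyset$, $U_\alpha=X$, $U_\xi\subseteq U_\eta$ for $\xi\le\eta<\alpha$, $U_\gamma=\bigcup_{\xi<\gamma}U_\xi$ for every limit ordinal $\gamma\in[0,\alpha]$, and $\operatorname{diam} f(U_{\xi+1}\setminus U_\xi)<\varepsilon$ for all $\xi<\alpha$. Then: (1) $f$ is $\sigma$-discrete, i.e. there are families $\mathscr B_n$ ($n\in\omega$) of subsets of $X$, each of them discrete (every point of $X$ has a neighborhood which intersects at most one member of $\mathscr B_n$), such that the preimage $f^{-1}(V)$ of every open $V\subseteq Y$ is a union of members of $\bigcup_n\mathscr B_n$; and $f$ is functionally $F_\sigma$-measurable, i.e. $f^{-1}(V)$ is a countable union of functionally closed sets for every open $V\subseteq Y$. (2) $f$ is Baire-one, i.e.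 the pointwise limit of a sequence of continuous maps $X\to Y$, provided that $Y$ is a weak adhesive and a locally weak adhesive for $X$. Here $Y$ is a weak adhesive for $X$ if for all $y,z\in Y$ and all disjoint functionally closed sets $A,B\subseteq X$ there is a continuous $h:X\to Y$ with $h|_A=y$ and $h|_B=z$; and $Y$ is a locally weak adhesive for $X$ if every neighborhood $V$ of every $y\in Y$ contains a neighborhood $U$ of $y$ such that for all $z\in U$ and all disjoint functionally closed sets $A,B\subseteq X$ there is a continuous $h:X\to V$ with $h|_A=y$ and $h|_B=z$. (3) If $X$ is Lindelöf, then $f$ is countably functionally fragmented, i.e. for every $\varepsilon>0$ the ordinal $\alpha$ and the sets $U_\xi$ above can be chosen with $\alpha$ countable. -/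

import Mathlib

open Set Filter Topology

universe u v

namespace Frag

section Sets

variable {X : Type u} [TopologicalSpace X]

/-- Functionally closed sets (zero sets of continuous real functions). -/
def FunctionallyClosed (A : Set X) : Prop :=
  ∃ g : X → ℝ, Continuous g ∧ A = g ⁻¹' {0}

/-- Functionally open sets (cozero sets of continuous real functions). -/
def FunctionallyOpen (U : Set X) : Prop :=
  ∃ g : X → ℝ, Continuous g ∧ U = {x | g x ≠ 0}

/-- A transfinite sequence `(U ξ : ξ ∈ [0, α])` regular in `X`. Values beyond `α` are ignored.
`Order.IsSuccLimit γ` says that `γ` is a nonzero limit ordinal. -/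
structure IsRegularSeq (α : Ordinal.{u}) (U : Ordinal.{u} → Set X) : Prop where
  isOpen : ∀ ξ ≤ α, IsOpen (U ξ)
  zero : U 0 = ∅
  top : U α = univ
  mono : ∀ ξ η, ξ ≤ η → η < α → U ξ ⊆ U η
  limit : ∀ γ ≤ α, Order.IsSuccLimit γ → U γ = ⋃ ξ, ⋃ (_ : ξ < γ), U ξ

/-- A family of sets is discrete if each point has a neighborhood which intersects at most one
member of the family. -/
def IsDiscreteFamily (𝒜 : Set (Set X)) : Prop :=
  ∀ x : X, ∃ O ∈ 𝓝 x, {A ∈ 𝒜 | (A ∩ O).Nonempty}.Subsingleton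

end Sets

section Maps

variable {X : Type u} {Y : Type v} [TopologicalSpace X]

/-- The regular sequence `(U ξ : ξ ∈ [0, α])` is `ε`-associated with `f`. The diameter is taken
in `[0, ∞]`, so it is infinite on unbounded sets. -/
def IsAssociated [MetricSpace Y] (f : X → Y) (ε : ℝ) (α : Ordinal.{u})
    (U : Ordinal.{u} → Set X) : Prop :=
  IsRegularSeq α U ∧
    ∀ ξ < α, Metric.ediam (f '' (U (Order.succ ξ) \ U ξ)) < ENNReal.ofReal ε

/-- Functionally fragmented maps: for each `ε > 0` there is an `ε`-associated regular sequence of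
functionally open sets. A regular sequence without repetitions has length less than the successor
cardinal of `#X` (and repetitions can be deleted), so ordinals in the universe of `X` suffice. -/
def FunctionallyFragmented [MetricSpace Y] (f : X → Y) : Prop :=
  ∀ ε : ℝ, 0 < ε → ∃ (α : Ordinal.{u}) (U : Ordinal.{u} → Set X),
    IsAssociated f ε α U ∧ ∀ ξ ≤ α, FunctionallyOpen (U ξ)

/-- Functionally countably fragmented maps: the sequences can be chosen countable. -/
def CountablyFunctionallyFragmented [MetricSpace Y] (f : X → Y) : Prop :=
  ∀ ε : ℝ, 0 < ε → ∃ (α : Ordinal.{u}) (U : Ordinal.{u} → Set X),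
    α.card ≤ Cardinal.aleph0 ∧ IsAssociated f ε α U ∧ ∀ ξ ≤ α, FunctionallyOpen (U ξ)

variable [TopologicalSpace Y]

/-- `ℬ` is a base for the map `f`. -/
def IsBaseFor (f : X → Y) (ℬ : Set (Set X)) : Prop :=
  ∀ V : Set Y, IsOpen V → ∃ 𝒮 ⊆ ℬ, f ⁻¹' V = ⋃₀ 𝒮

/-- `σ`-discrete maps. -/
def SigmaDiscrete (f : X → Y) : Prop :=
  ∃ ℬ : ℕ → Set (Set X), (∀ n, IsDiscreteFamily (ℬ n)) ∧ IsBaseFor f (⋃ n, ℬ n)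

/-- Functionally `F_σ`-measurable maps. -/
def FunctionallyFSigmaMeasurable (f : X → Y) : Prop :=
  ∀ V : Set Y, IsOpen V →
    ∃ F : ℕ → Set X, (∀ n, FunctionallyClosed (F n)) ∧ f ⁻¹' V = ⋃ n, F n

/-- Baire-one maps: pointwise limits of sequences of continuous maps. -/
def BaireOne (f : X → Y) : Prop :=
  ∃ F : ℕ → X → Y, (∀ n, Continuous (F n)) ∧ ∀ x, Tendsto (fun n => F n x) atTop (𝓝 (f x))

end Maps

section Adhesive

/-- `Y` is a weak adhesive for `X`. -/
def WeakAdhesive (X : Type u) (Y : Type v) [TopologicalSpace X] [TopologicalSpace Y] : Prop :=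
  ∀ (y z : Y) (A B : Set X), FunctionallyClosed A → FunctionallyClosed B → Disjoint A B →
    ∃ h : X → Y, Continuous h ∧ (∀ x ∈ A, h x = y) ∧ (∀ x ∈ B, h x = z)

/-- `Y` is a locally weak adhesive for `X`. -/
def LocallyWeakAdhesive (X : Type u) (Y : Type v) [TopologicalSpace X] [TopologicalSpace Y] :
    Prop :=
  ∀ (y : Y), ∀ V ∈ 𝓝 y, ∃ U ∈ 𝓝 y, U ⊆ V ∧
    ∀ z ∈ U, ∀ A B : Set X, FunctionallyClosed A → FunctionallyClosed B → Disjoint A B →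
      ∃ h : X → Y, Continuous h ∧ (∀ x, h x ∈ V) ∧ (∀ x ∈ A, h x = y) ∧ (∀ x ∈ B, h x = z)

end Adhesive

end Frag

/-! The proof rests on the entry index of a point: the least ξ with x ∈ U ξ. It is always a
successor, so points with equal index have images less than ε apart. The crux is
`IsRegularSeq.exists_decomposition`, which covers X by countably many functionally closed sets on
each of which the entry index is locally constant. The induction is delicate at a limit γ, where
possibly uncountably many U i must be combined: a subordinate partition of unity with well-ordered
indices sorts the points by the first function that is positive. This gives discrete families, and
paracompactness keeps their unions functionally closed.

With ε = 1/(n+1) the entry indices become labels q n. The label fibers inside the closed pieces form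
the discrete families of (1), and unions of such fibers give the F_σ representation. In a Lindelöf
space each piece carries only countably many labels, so countably many indices occur and the
sequence can be compressed; this is (3).

For (2), f is approximated by maps y n, each locally constant on the stages of an increasing
functionally closed exhaustion, with y (n+1) x in the adhesive neighborhood of y n x
(`FunctionallyFragmented.exists_approx`). At a fixed stage N, `exists_modification` turns a
continuous map that agrees with y n into one that agrees with y (n+1), moving each value by less
than 2⁻ⁿ. The diagonal of the resulting array converges to f. -/

namespace Frag

/-! ### Calculus of zero and cozero sets. -/

section ZeroSets

variable {X : Type u} [TopologicalSpace X]

theorem FunctionallyClosed.isClosed {A : Set X} (hA : FunctionallyClosed A) : IsClosed A := by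
  obtain ⟨g, hg, rfl⟩ := hA
  exact isClosed_singleton.preimage hg

theorem FunctionallyOpen.isOpen {U : Set X} (hU : FunctionallyOpen U) : IsOpen U := by
  obtain ⟨g, hg, rfl⟩ := hU
  exact isOpen_ne_fun hg continuous_const

theorem FunctionallyOpen.compl {U : Set X} (hU : FunctionallyOpen U) :
    FunctionallyClosed Uᶜ := by
  obtain ⟨g, hg, rfl⟩ := hU
  exact ⟨g, hg, by ext x; simp⟩

theorem FunctionallyClosed.compl {A : Set X} (hA : FunctionallyClosed A) :
    FunctionallyOpen Aᶜ := by
  obtain ⟨g, hg, rfl⟩ := hA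
  exact ⟨g, hg, by ext x; simp⟩

theorem functionallyClosed_le {g h : X → ℝ} (hg : Continuous g) (hh : Continuous h) :
    FunctionallyClosed {x | g x ≤ h x} :=
  ⟨fun x => max (g x - h x) 0, by fun_prop, by ext x; simp⟩

theorem functionallyClosed_univ : FunctionallyClosed (univ : Set X) :=
  ⟨fun _ => 0, continuous_const, by ext x; simp⟩

theorem functionallyClosed_empty : FunctionallyClosed (∅ : Set X) :=
  ⟨fun _ => 1, continuous_const, by ext x; simp⟩

theorem FunctionallyClosed.inter {A B : Set X} (hA : FunctionallyClosed A)
    (hB : FunctionallyClosed B) : FunctionallyClosed (A ∩ B) := by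
  obtain ⟨g, hg, rfl⟩ := hA
  obtain ⟨h, hh, rfl⟩ := hB
  refine ⟨fun x => |g x| + |h x|, by fun_prop, ?_⟩
  ext x
  simp [add_eq_zero_iff_of_nonneg (abs_nonneg (g x)) (abs_nonneg (h x))]

theorem FunctionallyClosed.union {A B : Set X} (hA : FunctionallyClosed A)
    (hB : FunctionallyClosed B) : FunctionallyClosed (A ∪ B) := by
  obtain ⟨g, hg, rfl⟩ := hA
  obtain ⟨h, hh, rfl⟩ := hB
  exact ⟨fun x => g x * h x, by fun_prop, by ext x; simp⟩

theorem FunctionallyClosed.biUnion_lt {F : ℕ → Set X} (hF : ∀ n, FunctionallyClosed (F n))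
    (N : ℕ) : FunctionallyClosed (⋃ n < N, F n) := by
  induction N with
  | zero => simpa using functionallyClosed_empty
  | succ N ih =>
    rw [biUnion_lt_succ]
    exact ih.union (hF N)

theorem FunctionallyClosed.biInter_le {F : ℕ → Set X} (hF : ∀ n, FunctionallyClosed (F n))
    (N : ℕ) : FunctionallyClosed (⋂ n ≤ N, F n) := by
  induction N with
  | zero => simpa using hF 0
  | succ N ih =>
    rw [biInter_le_succ]
    exact ih.inter (hF (N + 1))

/-- A functionally open set is the union of an increasing sequence of functionally closed sets. -/
theorem FunctionallyOpen.exists_monotone {U : Set X} (hU : FunctionallyOpen U) :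
    ∃ Z : ℕ → Set X, Monotone Z ∧ (∀ n, FunctionallyClosed (Z n)) ∧ ⋃ n, Z n = U := by
  obtain ⟨g, hg, rfl⟩ := hU
  refine ⟨fun n => {x | 1 / ((n : ℝ) + 1) ≤ |g x|}, fun m n hmn x hx => ?_,
    fun n => functionallyClosed_le continuous_const hg.abs, ?_⟩
  · have hx' : 1 / ((m : ℝ) + 1) ≤ |g x| := hx
    exact (Nat.one_div_le_one_div hmn).trans hx'
  · ext x
    simp only [mem_iUnion, mem_ofPred_eq]
    constructor
    · rintro ⟨n, hn⟩
      exact abs_pos.1 (lt_of_lt_of_le (by positivity) hn)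
    · intro hx
      obtain ⟨n, hn⟩ := exists_nat_one_div_lt (abs_pos.2 hx)
      exact ⟨n, hn.le⟩

/-- Truncation at 1 and geometric weights make the series of the |g n| converge uniformly. Its terms
are nonnegative, so the sum vanishes only where all g n do. -/
theorem FunctionallyOpen.iUnion {U : ℕ → Set X} (hU : ∀ n, FunctionallyOpen (U n)) :
    FunctionallyOpen (⋃ n, U n) := by
  choose g hg hgU using hU
  have hb : ∀ n x, ‖min |g n x| 1 * (1 / 2 : ℝ) ^ n‖ ≤ (1 / 2 : ℝ) ^ n := by
    intro n x
    rw [Real.norm_of_nonneg (by positivity)]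
    exact mul_le_of_le_one_left (by positivity) (min_le_right _ _)
  have hs : Summable fun n : ℕ => (1 / 2 : ℝ) ^ n := summable_geometric_two
  refine ⟨fun x => ∑' n, min |g n x| 1 * (1 / 2 : ℝ) ^ n,
    continuous_tsum (fun n => by have := hg n; fun_prop) hs hb, ?_⟩
  ext x
  have hsx : Summable fun n => min |g n x| 1 * (1 / 2 : ℝ) ^ n :=
    Summable.of_norm_bounded hs fun n => hb n x
  have h0 : ∀ n, 0 ≤ min |g n x| 1 * (1 / 2 : ℝ) ^ n := fun n => by positivity
  have key : (∑' n, min |g n x| 1 * (1 / 2 : ℝ) ^ n = 0) ↔ ∀ n, g n x = 0 := by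
    rw [← hsx.hasSum_iff, hasSum_zero_iff_of_nonneg h0]
    constructor
    · intro h n
      have := congrFun h n
      by_contra hne
      have hpos : 0 < min |g n x| 1 * (1 / 2 : ℝ) ^ n := by
        have := abs_pos.2 hne
        positivity
      exact hpos.ne' this
    · intro h
      funext n
      simp [h n]
  simp only [mem_iUnion, mem_ofPred_eq, ne_eq, key, not_forall]
  exact exists_congr fun n => by rw [hgU n]; rfl

theorem FunctionallyOpen.iUnion_of_countable {ι : Type*} [Countable ι] {U : ι → Set X}
    (hU : ∀ i, FunctionallyOpen (U i)) : FunctionallyOpen (⋃ i, U i) := by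
  rcases isEmpty_or_nonempty ι with h | h
  · simpa using functionallyClosed_univ.compl (X := X)
  · obtain ⟨e, he⟩ := exists_surjective_nat ι
    rw [← he.iUnion_comp]
    exact FunctionallyOpen.iUnion fun n => hU (e n)

end ZeroSets

/-! ### Relative local constancy and discrete families. -/

section LocallyConstant

variable {X : Type u} [TopologicalSpace X] {T : Type*}

/-- The restriction of `q` to `F` is locally constant. -/
def LocConstOn (q : X → T) (F : Set X) : Prop :=
  ∀ x ∈ F, ∀ᶠ x' in 𝓝[F] x, q x' = q x

theorem LocConstOn.mono {q : X → T} {F G : Set X} (h : LocConstOn q F) (hG : G ⊆ F) :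
    LocConstOn q G :=
  fun x hx => (h x (hG hx)).filter_mono (nhdsWithin_mono x hG)

theorem LocConstOn.prodMk {S : Type*} {q : X → T} {r : X → S} {F : Set X}
    (hq : LocConstOn q F) (hr : LocConstOn r F) : LocConstOn (fun x => (q x, r x)) F := by
  intro x hx
  filter_upwards [hq x hx, hr x hx] with x' h1 h2
  rw [h1, h2]

theorem LocConstOn.comp {S : Type*} {q : X → T} {F : Set X} (hq : LocConstOn q F) (φ : T → S) :
    LocConstOn (fun x => φ (q x)) F := by
  intro x hx
  filter_upwards [hq x hx] with x' h1
  rw [h1]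

theorem LocConstOn.congr {q r : X → T} {F : Set X} (hq : LocConstOn q F)
    (h : ∀ x ∈ F, q x = r x) : LocConstOn r F := by
  intro x hx
  filter_upwards [hq x hx, self_mem_nhdsWithin] with x' h1 h2
  rw [← h x' h2, ← h x hx, h1]

theorem LocConstOn.union {q : X → T} {F G : Set X} (hF : LocConstOn q F) (hG : LocConstOn q G)
    (hFc : IsClosed F) (hGc : IsClosed G) (hd : Disjoint F G) : LocConstOn q (F ∪ G) := by
  rintro x (hx | hx) <;> rw [nhdsWithin_union, eventually_sup]
  · have : x ∈ Gᶜ := fun h => hd.le_bot ⟨hx, h⟩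
    refine ⟨hF x hx, ?_⟩
    have h2 := hGc.isOpen_compl.mem_nhds this
    filter_upwards [mem_nhdsWithin_of_mem_nhds h2, self_mem_nhdsWithin] with y hy hy'
    exact absurd hy' hy
  · have : x ∈ Fᶜ := fun h => hd.le_bot ⟨h, hx⟩
    refine ⟨?_, hG x hx⟩
    have h2 := hFc.isOpen_compl.mem_nhds this
    filter_upwards [mem_nhdsWithin_of_mem_nhds h2, self_mem_nhdsWithin] with y hy hy'
    exact absurd hy' hy

theorem LocConstOn.biUnion_lt {q : X → T} {F : ℕ → Set X} (hF : ∀ n, LocConstOn q (F n))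
    (hc : ∀ n, FunctionallyClosed (F n)) (hd : Pairwise fun m n => Disjoint (F m) (F n)) (N : ℕ) :
    LocConstOn q (⋃ n < N, F n) := by
  induction N with
  | zero => intro x hx; simp at hx
  | succ N ih =>
    rw [biUnion_lt_succ]
    refine ih.union (hF N) (FunctionallyClosed.biUnion_lt hc N).isClosed (hc N).isClosed ?_
    simp only [disjoint_iUnion_left]
    exact fun n hn => hd hn.ne

theorem LocConstOn.isClosed {q : X → T} {F : Set X} (hq : LocConstOn q F) (hF : IsClosed F)
    (S : Set T) : IsClosed {x ∈ F | q x ∈ S} := by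
  rw [← isOpen_compl_iff, isOpen_iff_mem_nhds]
  intro x hx
  by_cases hxF : x ∈ F
  · have hxS : q x ∉ S := fun h => hx ⟨hxF, h⟩
    filter_upwards [eventually_nhdsWithin_iff.1 (hq x hxF)] with y hy hyF
    exact hxS (hy hyF.1 ▸ hyF.2)
  · filter_upwards [hF.isOpen_compl.mem_nhds hxF] with y hy hyF
    exact hy hyF.1

/-- Local constancy splits F into two disjoint closed parts, according to S and its complement; a
Urysohn function for them cuts out the first part. -/
theorem LocConstOn.functionallyClosed [NormalSpace X] {q : X → T} {F : Set X}
    (hq : LocConstOn q F) (hF : FunctionallyClosed F) (S : Set T) :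
    FunctionallyClosed {x ∈ F | q x ∈ S} := by
  have hd : Disjoint {x ∈ F | q x ∈ S} {x ∈ F | q x ∈ Sᶜ} :=
    disjoint_left.2 fun x hx hx' => hx'.2 hx.2
  obtain ⟨φ, h0, h1, -⟩ := exists_continuous_zero_one_of_isClosed (hq.isClosed hF.isClosed S)
    (hq.isClosed hF.isClosed Sᶜ) hd
  have : {x ∈ F | q x ∈ S} = F ∩ {x | |φ x| ≤ 0} := by
    ext x
    refine and_congr_right fun hx => ⟨fun h => ?_, fun h => ?_⟩
    · have := h0 ⟨hx, h⟩
      simp_all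
    · by_contra hn
      have h1' := h1 ⟨hx, hn⟩
      simp only [mem_ofPred_eq, h1'] at h
      norm_num at h
  rw [this]
  exact hF.inter (functionallyClosed_le φ.continuous.abs continuous_const)

/-- An indexed family is discrete if each point has a neighborhood meeting at most one of its
members. -/
def DiscreteIndexed (B : T → Set X) : Prop :=
  ∀ x, ∃ O ∈ 𝓝 x, ∀ s t, (B s ∩ O).Nonempty → (B t ∩ O).Nonempty → s = t

theorem DiscreteIndexed.mono {B C : T → Set X} (h : DiscreteIndexed B) (hC : ∀ t, C t ⊆ B t) :
    DiscreteIndexed C := by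
  intro x
  obtain ⟨O, hO, hOB⟩ := h x
  exact ⟨O, hO, fun s t hs ht => hOB s t (hs.mono (inter_subset_inter_left _ (hC s)))
    (ht.mono (inter_subset_inter_left _ (hC t)))⟩

theorem DiscreteIndexed.locallyFinite {B : T → Set X} (h : DiscreteIndexed B) :
    LocallyFinite B := by
  intro x
  obtain ⟨O, hO, hOB⟩ := h x
  exact ⟨O, hO, Set.Subsingleton.finite fun s hs t ht => hOB s t hs ht⟩

theorem DiscreteIndexed.disjoint {B : T → Set X} (h : DiscreteIndexed B) {s t : T} {x : X}
    (hs : x ∈ B s) (ht : x ∈ B t) : s = t := by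
  obtain ⟨O, hO, hOB⟩ := h x
  exact hOB s t ⟨x, hs, mem_of_mem_nhds hO⟩ ⟨x, ht, mem_of_mem_nhds hO⟩

theorem DiscreteIndexed.isDiscreteFamily {B : T → Set X} (h : DiscreteIndexed B) :
    IsDiscreteFamily (range B) := by
  intro x
  obtain ⟨O, hO, hOB⟩ := h x
  refine ⟨O, hO, ?_⟩
  rintro _ ⟨⟨s, rfl⟩, hs⟩ _ ⟨⟨t, rfl⟩, ht⟩
  rw [hOB s t hs ht]

theorem LocConstOn.discreteIndexed {q : X → T} {F : Set X} (hq : LocConstOn q F)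
    (hF : IsClosed F) : DiscreteIndexed fun t => {x ∈ F | q x ∈ ({t} : Set T)} := by
  intro x
  by_cases hx : x ∈ F
  · refine ⟨_, eventually_nhdsWithin_iff.1 (hq x hx), ?_⟩
    rintro s t ⟨y, ⟨hy, rfl⟩, hyO⟩ ⟨z, ⟨hz, rfl⟩, hzO⟩
    exact (hyO hy).trans (hzO hz).symm
  · refine ⟨Fᶜ, hF.isOpen_compl.mem_nhds hx, ?_⟩
    rintro s t ⟨y, ⟨hy, -⟩, hyO⟩
    exact absurd hy hyO

/-- The union of a discrete family of functionally closed sets in a paracompact Hausdorff space is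
functionally closed. -/
theorem DiscreteIndexed.functionallyClosed_iUnion [T2Space X] [ParacompactSpace X]
    {B : T → Set X} (hB : DiscreteIndexed B) (hc : ∀ t, FunctionallyClosed (B t)) :
    FunctionallyClosed (⋃ t, B t) := by
  rcases isEmpty_or_nonempty T with hT | ⟨⟨t₀⟩⟩
  · simpa using functionallyClosed_empty
  choose g hg hgB using hc
  -- Since O t omits every other member, a subordinate partition of unity has φ t = 1 on B t and all
  -- other functions zero there.
  let O : T → Set X := fun t => (⋃ s : {s // s ≠ t}, B s)ᶜ
  have hO : ∀ t, IsOpen (O t) := fun t => by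
    rw [isOpen_compl_iff]
    refine (hB.locallyFinite.comp_injective Subtype.val_injective).isClosed_iUnion fun s => ?_
    exact FunctionallyClosed.isClosed ⟨g s, hg s, hgB s⟩
  have hcov : (univ : Set X) ⊆ ⋃ t, O t := by
    intro x _
    by_cases hx : ∃ t, x ∈ B t
    · obtain ⟨t, ht⟩ := hx
      refine mem_iUnion.2 ⟨t, fun h => ?_⟩
      obtain ⟨s, hs⟩ := mem_iUnion.1 h
      exact s.2 (hB.disjoint hs ht)
    · refine mem_iUnion.2 ⟨t₀, fun h => ?_⟩
      obtain ⟨s, hs⟩ := mem_iUnion.1 h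
      exact hx ⟨s, hs⟩
  obtain ⟨φ, hφ⟩ := PartitionOfUnity.exists_isSubordinate isClosed_univ O hO hcov
  have hφ0 : ∀ {s t x}, x ∈ B t → s ≠ t → φ s x = 0 := by
    intro s t x hx hst
    by_contra hne
    exact hφ s (subset_closure hne) (mem_iUnion.2 ⟨⟨t, hst.symm⟩, hx⟩)
  have hφ1 : ∀ {t x}, x ∈ B t → φ t x = 1 := by
    intro t x hx
    rw [← φ.sum_eq_one (mem_univ x)]
    exact (finsum_eq_single _ t fun s hs => hφ0 hx hs).symm
  -- All summands are nonnegative. On B t the only active one has φ t = 1 and g t = 0; conversely,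
  -- if the sum vanishes, any t with φ t x > 0 must satisfy g t x = 0.
  refine ⟨fun x => ∑ᶠ t, φ t x • (|g t x| + (1 - φ t x)),
    φ.continuous_finsum_smul fun t x _ => ?_, ?_⟩
  · have := hg t
    have := (φ t).continuous
    exact Continuous.continuousAt (by fun_prop)
  · have hn : ∀ t x, 0 ≤ φ t x • (|g t x| + (1 - φ t x)) := fun t x =>
      mul_nonneg (φ.nonneg t x) (add_nonneg (abs_nonneg _) (sub_nonneg.2 (φ.le_one t x)))
    ext x
    simp only [mem_iUnion, mem_preimage, mem_singleton_iff]
    constructor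
    · rintro ⟨t, ht⟩
      refine finsum_eq_zero_of_forall_eq_zero fun s => ?_
      by_cases hs : s = t
      · subst hs
        have h0 : g s x = 0 := by rw [hgB s] at ht; exact ht
        simp [hφ1 ht, h0]
      · simp [hφ0 ht hs]
    · intro h
      obtain ⟨t, ht⟩ := φ.exists_pos (mem_univ x)
      refine ⟨t, ?_⟩
      have hfin : (Function.support fun t => φ t x • (|g t x| + (1 - φ t x))).Finite :=
        (φ.locallyFinite.point_finite x).subset fun s hs => by
          intro h0
          exact hs (by simp [h0])
      have hle : φ t x • (|g t x| + (1 - φ t x)) ≤ 0 :=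
        h ▸ single_le_finsum t hfin fun s => hn s x
      have hz := nonpos_of_mul_nonpos_right hle ht
      have := abs_nonneg (g t x)
      have := φ.le_one t x
      rw [hgB t]
      exact abs_eq_zero.1 (by linarith)

end LocallyConstant

/-- The first index at which a point enters the sequence. -/
noncomputable def entry {X : Type u} (U : Ordinal.{u} → Set X) (x : X) : Ordinal.{u} :=
  sInf {ξ | x ∈ U ξ}

theorem entry_le {X : Type u} {U : Ordinal.{u} → Set X} {x : X} {ξ : Ordinal.{u}} (h : x ∈ U ξ) :
    entry U x ≤ ξ :=
  csInf_le' h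

theorem exists_ball_label {X : Type u} {Y : Type v} [MetricSpace Y] {f : X → Y} {q : ℕ → X → Ordinal.{u}}
    (hq : ∀ n x x', q n x = q n x' → dist (f x) (f x') < 1 / ((n : ℝ) + 1)) {V : Set Y} {x : X}
    (hV : V ∈ 𝓝 (f x)) : ∃ n, ∀ x', q n x' = q n x → f x' ∈ V := by
  obtain ⟨ε, hε, hball⟩ := Metric.mem_nhds_iff.1 hV
  obtain ⟨n, hn⟩ := exists_nat_one_div_lt hε
  exact ⟨n, fun x' h => hball ((hq n x' x h).trans hn)⟩

/-! ### Entry indices and the decomposition of regular sequences. -/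

section Entry

variable {X : Type u} [TopologicalSpace X]

theorem DiscreteIndexed.locConstOn_iUnion {T S : Type*} {B : T → Set X} (hB : DiscreteIndexed B)
    {q : X → S} (hq : ∀ t, LocConstOn q (B t)) : LocConstOn q (⋃ t, B t) := by
  intro x hx
  obtain ⟨t, ht⟩ := mem_iUnion.1 hx
  obtain ⟨O, hO, hOB⟩ := hB x
  rw [eventually_nhdsWithin_iff]
  filter_upwards [hO, eventually_nhdsWithin_iff.1 (hq t x ht)] with y hy hyt hyB
  obtain ⟨s, hs⟩ := mem_iUnion.1 hyB
  obtain rfl := hOB s t ⟨y, hs, hy⟩ ⟨x, ht, mem_of_mem_nhds hO⟩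
  exact hyt hs

/-- In a partition of unity with linearly ordered indices, the sets of those points at which `φ i`
is the first nonzero function and has a value at least `ε` form a discrete family. -/
theorem discreteIndexed_first {ι : Type*} [LinearOrder ι] {s : Set X}
    (φ : PartitionOfUnity ι X s) {ε : ℝ} (hε : 0 < ε) :
    DiscreteIndexed fun i => {x | ε ≤ φ i x ∧ ∀ j < i, φ j x = 0} := by
  intro x
  obtain ⟨O, hO, hfin⟩ := φ.locallyFinite x
  -- Two distinct members i < j near x would require φ i to be at least ε at one point and 0 at
  -- another, but the relevant finitely many functions oscillate by less than ε.
  have hN : ∀ᶠ y in 𝓝 x, ∀ i ∈ {i | (Function.support (φ i) ∩ O).Nonempty},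
      |φ i y - φ i x| < ε / 2 := by
    refine (Filter.eventually_all_finite hfin).2 fun i _ => ?_
    have := (φ i).continuous.continuousAt (x := x)
    have h2 := Metric.tendsto_nhds.1 this (ε / 2) (by positivity)
    simpa [Real.dist_eq] using h2
  refine ⟨_, inter_mem hO hN, ?_⟩
  have key : ∀ i j, i < j → ∀ y z,
      y ∈ {x | ε ≤ φ i x ∧ ∀ j < i, φ j x = 0} → z ∈ {x | ε ≤ φ j x ∧ ∀ k < j, φ k x = 0} →
      y ∈ O → (∀ i ∈ {i | (Function.support (φ i) ∩ O).Nonempty}, |φ i y - φ i x| < ε / 2) →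
      (∀ i ∈ {i | (Function.support (φ i) ∩ O).Nonempty}, |φ i z - φ i x| < ε / 2) → False := by
    intro i j hij y z hy hz hyO h1 h2
    have hi : i ∈ {i | (Function.support (φ i) ∩ O).Nonempty} :=
      ⟨y, (hε.trans_le hy.1).ne', hyO⟩
    have a := abs_lt.1 (h1 i hi)
    have b := abs_lt.1 (h2 i hi)
    have := hy.1
    have := hz.2 i hij
    linarith
  rintro i j ⟨y, hy, hyO, hyN⟩ ⟨z, hz, hzO, hzN⟩
  rcases lt_trichotomy i j with h | h | h
  · exact (key i j h y z hy hz hyO hyN hzN).elim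
  · exact h
  · exact (key j i h z y hz hy hzO hzN hyN).elim

theorem functionallyClosed_first {ι : Type*} [LinearOrder ι] {s : Set X}
    (φ : PartitionOfUnity ι X s) (ε : ℝ) (i : ι) :
    FunctionallyClosed {x | ε ≤ φ i x ∧ ∀ j < i, φ j x = 0} := by
  have hlf : LocallyFinite fun j : {j // j < i} => Function.support fun x => φ j x :=
    φ.locallyFinite.comp_injective Subtype.val_injective
  -- The possibly infinitely many conditions φ j x = 0 collapse into the vanishing of one continuous
  -- nonnegative sum.
  have hc : Continuous fun x => ∑ᶠ j : {j // j < i}, φ j x :=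
    continuous_finsum (fun j => (φ j).continuous) hlf
  convert (functionallyClosed_le (continuous_const (y := ε)) (φ i).continuous).inter
    (functionallyClosed_le hc (continuous_const (y := 0))) using 1
  ext x
  refine and_congr_right fun _ => ⟨fun h => ?_, fun h j hj => ?_⟩
  · exact (finsum_eq_zero_of_forall_eq_zero fun j : {j // j < i} => h j j.2).le
  · have h2 := single_le_finsum (⟨j, hj⟩ : {j // j < i}) (hlf.point_finite x)
      fun k => φ.nonneg k x
    exact le_antisymm (h2.trans h) (φ.nonneg j x)

theorem exists_seq_of_countable {ι S : Type*} [Countable ι] [Nonempty ι] {q : X → S}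
    {F : ι → Set X} {A : Set X} (hc : ∀ i, FunctionallyClosed (F i)) (hq : ∀ i, LocConstOn q (F i))
    (hA : ⋃ i, F i = A) :
    ∃ G : ℕ → Set X, (∀ n, FunctionallyClosed (G n)) ∧ (∀ n, LocConstOn q (G n)) ∧
      ⋃ n, G n = A := by
  obtain ⟨e, he⟩ := exists_surjective_nat ι
  exact ⟨fun n => F (e n), fun n => hc _, fun n => hq _, (he.iUnion_comp F).trans hA⟩

theorem IsRegularSeq.subset {α : Ordinal.{u}} {U : Ordinal.{u} → Set X} (hU : IsRegularSeq α U)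
    {ξ η : Ordinal.{u}} (h : ξ ≤ η) (hη : η ≤ α) : U ξ ⊆ U η := by
  rcases hη.lt_or_eq with h' | rfl
  · exact hU.mono ξ η h h'
  · rw [hU.top]
    exact subset_univ _

theorem IsRegularSeq.mem_entry {α : Ordinal.{u}} {U : Ordinal.{u} → Set X}
    (hU : IsRegularSeq α U) (x : X) : x ∈ U (entry U x) := by
  have : x ∈ U α := hU.top ▸ mem_univ x
  exact csInf_mem (s := {ξ | x ∈ U ξ}) ⟨α, this⟩

theorem IsRegularSeq.entry_le_top {α : Ordinal.{u}} {U : Ordinal.{u} → Set X}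
    (hU : IsRegularSeq α U) (x : X) : entry U x ≤ α :=
  entry_le (hU.top ▸ mem_univ x)

theorem IsRegularSeq.mem_iff {α : Ordinal.{u}} {U : Ordinal.{u} → Set X}
    (hU : IsRegularSeq α U) {ξ : Ordinal.{u}} (hξ : ξ ≤ α) {x : X} :
    x ∈ U ξ ↔ entry U x ≤ ξ :=
  ⟨entry_le, fun h => hU.subset h hξ (hU.mem_entry x)⟩

theorem IsRegularSeq.exists_entry_eq_succ {α : Ordinal.{u}} {U : Ordinal.{u} → Set X}
    (hU : IsRegularSeq α U) (x : X) : ∃ ξ < α, entry U x = Order.succ ξ := by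
  have hle := hU.entry_le_top x
  have hx := hU.mem_entry x
  rcases Ordinal.zero_or_succ_or_isSuccLimit (entry U x) with h | ⟨ξ, h⟩ | h
  · rw [h, hU.zero] at hx
    exact hx.elim
  · exact ⟨ξ, Order.succ_le_iff.1 (h ▸ hle), h.symm⟩
  · rw [hU.limit _ hle h] at hx
    simp only [mem_iUnion] at hx
    obtain ⟨ξ, hξ, hxξ⟩ := hx
    exact absurd (entry_le hxξ) hξ.not_ge

theorem IsAssociated.dist_lt {Y : Type v} [MetricSpace Y] {f : X → Y} {ε : ℝ} (hε : 0 < ε)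
    {α : Ordinal.{u}} {U : Ordinal.{u} → Set X} (hU : IsAssociated f ε α U) {x x' : X}
    (h : entry U x = entry U x') : dist (f x) (f x') < ε := by
  obtain ⟨ξ, hξ, hx⟩ := hU.1.exists_entry_eq_succ x
  have hm : ∀ y, entry U y = Order.succ ξ → f y ∈ f '' (U (Order.succ ξ) \ U ξ) := by
    intro y hy
    refine mem_image_of_mem f ⟨hy ▸ hU.1.mem_entry y, fun hn => ?_⟩
    exact (Order.lt_succ ξ).not_ge (hy ▸ entry_le hn)
  have h1 := (Metric.edist_le_ediam_of_mem (hm x hx) (hm x' (h ▸ hx))).trans_lt (hU.2 ξ hξ)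
  rw [edist_dist] at h1
  exact (ENNReal.ofReal_lt_ofReal_iff hε).1 h1

/-- The sets of a regular sequence of functionally open sets in a paracompact Hausdorff space are
countable unions of functionally closed sets on which the entry index is locally constant. -/
theorem IsRegularSeq.exists_decomposition [T2Space X] [ParacompactSpace X] {α : Ordinal.{u}}
    {U : Ordinal.{u} → Set X} (hU : IsRegularSeq α U) (hfo : ∀ ξ ≤ α, FunctionallyOpen (U ξ))
    (ξ : Ordinal.{u}) (hξ : ξ ≤ α) :
    ∃ F : ℕ → Set X, (∀ n, FunctionallyClosed (F n)) ∧ (∀ n, LocConstOn (entry U) (F n)) ∧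
      ⋃ n, F n = U ξ := by
  induction ξ using Ordinal.limitRecOn with
  | zero =>
    refine ⟨fun _ => ∅, fun _ => functionallyClosed_empty, fun _ x hx => hx.elim, ?_⟩
    simp [hU.zero]
  | add_one ξ ih =>
    rw [← Order.succ_eq_add_one] at hξ ⊢
    have hξ' : ξ < α := Order.succ_le_iff.1 hξ
    obtain ⟨F, hF, hFq, hFU⟩ := ih hξ'.le
    obtain ⟨Z, -, hZ, hZU⟩ := (hfo _ hξ).exists_monotone
    -- The newly added points all have index ξ + 1, so on the second kind of piece the entry index
    -- is constant.
    refine exists_seq_of_countable (ι := ℕ ⊕ ℕ) (F := Sum.elim F fun n => Z n ∩ (U ξ)ᶜ) ?_ ?_ ?_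
    · rintro (n | n)
      · exact hF n
      · exact (hZ n).inter (hfo ξ hξ'.le).compl
    · rintro (n | n)
      · exact hFq n
      · have hc : ∀ y ∈ Z n ∩ (U ξ)ᶜ, entry U y = Order.succ ξ := by
          rintro y ⟨hy, hy'⟩
          refine le_antisymm (entry_le (hZU ▸ mem_iUnion.2 ⟨n, hy⟩)) (Order.succ_le_of_lt ?_)
          exact lt_of_not_ge fun h => hy' ((hU.mem_iff hξ'.le).2 h)
        intro x hx
        filter_upwards [self_mem_nhdsWithin] with y hy
        rw [hc y hy, hc x hx]
    · rw [iUnion_sum]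
      simp only [Sum.elim_inl, Sum.elim_inr]
      rw [hFU, ← iUnion_inter, hZU]
      ext x
      have := fun h : x ∈ U ξ => hU.subset (Order.le_succ ξ) hξ h
      by_cases hx : x ∈ U ξ <;> simp [hx]
      exact this hx
  | limit γ hγ ih =>
    obtain ⟨Z, -, hZ, hZU⟩ := (hfo _ hξ).exists_monotone
    have hφ : ∀ m, ∃ φ : PartitionOfUnity (Iio γ) X (Z m), φ.IsSubordinate fun i => U i := by
      intro m
      refine PartitionOfUnity.exists_isSubordinate (hZ m).isClosed _
        (fun i => hU.isOpen _ (i.2.le.trans hξ)) ?_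
      refine (subset_iUnion Z m).trans ?_
      rw [hZU, hU.limit γ hξ hγ]
      exact iUnion₂_subset fun i hi => subset_iUnion (fun i : Iio γ => U i) ⟨i, hi⟩
    choose φ hφ using hφ
    have ih' : ∀ i : Iio γ, _ := fun i => ih i i.2 (i.2.le.trans hξ)
    choose F hF hFq hFU using ih'
    let K : ℕ → ℕ → Iio γ → Set X := fun m n i =>
      {x | 1 / ((n : ℝ) + 1) ≤ φ m i x ∧ ∀ j < i, φ m j x = 0}
    have hK : ∀ m n k, DiscreteIndexed fun i => K m n i ∩ F i k := fun m n k =>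
      (discreteIndexed_first (φ m) (by positivity)).mono fun i => inter_subset_left
    refine exists_seq_of_countable (ι := ℕ × ℕ × ℕ)
      (F := fun p => ⋃ i, K p.1 p.2.1 i ∩ F i p.2.2) ?_ ?_ ?_
    · rintro ⟨m, n, k⟩
      exact (hK m n k).functionallyClosed_iUnion fun i =>
        (functionallyClosed_first (φ m) _ i).inter (hF i k)
    · rintro ⟨m, n, k⟩
      exact (hK m n k).locConstOn_iUnion fun i => (hFq i k).mono inter_subset_right
    · refine Subset.antisymm ?_ ?_
      · refine iUnion_subset fun p => iUnion_subset fun i => inter_subset_right.trans ?_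
        refine (subset_iUnion (F i) _).trans ?_
        rw [hFU i]
        exact hU.subset i.2.le hξ
      · intro x hx
        rw [← hZU] at hx
        obtain ⟨m, hm⟩ := mem_iUnion.1 hx
        -- Well-ordering of the indices below γ provides a first positive function; its support lies
        -- in U i, where the inductive decomposition applies.
        have hne : {i | 0 < φ m i x}.Nonempty := (φ m).exists_pos hm
        let i := wellFounded_lt.min {i | 0 < φ m i x} hne
        have hi : 0 < φ m i x := wellFounded_lt.min_mem {i | 0 < φ m i x} hne
        have hlt : ∀ j < i, φ m j x = 0 := fun j hj =>
          le_antisymm (not_lt.1 fun h => wellFounded_lt.not_lt_min {i | 0 < φ m i x} h hj)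
            ((φ m).nonneg j x)
        obtain ⟨n, hn⟩ := exists_nat_one_div_lt hi
        have hxU : x ∈ U i := hφ m i (subset_closure hi.ne')
        rw [← hFU i] at hxU
        obtain ⟨k, hk⟩ := mem_iUnion.1 hxU
        exact mem_iUnion.2 ⟨(m, n, k), mem_iUnion.2 ⟨i, ⟨hn.le, hlt⟩, hk⟩⟩

theorem IsRegularSeq.exists_decomposition_univ [T2Space X] [ParacompactSpace X] {α : Ordinal.{u}}
    {U : Ordinal.{u} → Set X} (hU : IsRegularSeq α U) (hfo : ∀ ξ ≤ α, FunctionallyOpen (U ξ)) :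
    ∃ F : ℕ → Set X, (∀ n, FunctionallyClosed (F n)) ∧ (∀ n, LocConstOn (entry U) (F n)) ∧
      ⋃ n, F n = univ := by
  rw [← hU.top]
  exact hU.exists_decomposition hfo α le_rfl

end Entry

/-! ### σ-discreteness and functional F_σ-measurability. -/

section Base

variable {X : Type u} {Y : Type v} [TopologicalSpace X] [MetricSpace Y]

/-- A functionally fragmented map on a paracompact Hausdorff space is, up to any `ε`, determined by
a map that is locally constant on each member of a countable functionally closed cover. -/
theorem FunctionallyFragmented.exists_labels [T2Space X] [ParacompactSpace X] {f : X → Y}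
    (hf : FunctionallyFragmented f) :
    ∃ (q : ℕ → X → Ordinal.{u}) (F : ℕ → ℕ → Set X),
      (∀ n x x', q n x = q n x' → dist (f x) (f x') < 1 / ((n : ℝ) + 1)) ∧
      (∀ n k, FunctionallyClosed (F n k)) ∧ (∀ n k, LocConstOn (q n) (F n k)) ∧
      ∀ n, ⋃ k, F n k = univ := by
  have hpos : ∀ n : ℕ, 0 < 1 / ((n : ℝ) + 1) := fun n => by positivity
  choose α U hU hfo using fun n : ℕ => hf (1 / ((n : ℝ) + 1)) (hpos n)
  choose F hF hFq hFU using fun n => (hU n).1.exists_decomposition_univ (hfo n)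
  exact ⟨fun n => entry (U n), F, fun n x x' h => (hU n).dist_lt (hpos n) h, hF, hFq, hFU⟩

theorem FunctionallyFragmented.sigmaDiscrete [T2Space X] [ParacompactSpace X] {f : X → Y}
    (hf : FunctionallyFragmented f) : SigmaDiscrete f := by
  obtain ⟨q, F, hq, hF, hFq, hFU⟩ := hf.exists_labels
  let B : ℕ × ℕ → Ordinal.{u} → Set X := fun p t => {x ∈ F p.1 p.2 | q p.1 x ∈ ({t} : Set _)}
  refine ⟨fun n => range (B n.unpair), fun n => ?_, fun V hV => ?_⟩
  · exact ((hFq _ _).discreteIndexed (hF _ _).isClosed).isDiscreteFamily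
  · refine ⟨{A ∈ ⋃ n : ℕ, range (B n.unpair) | A ⊆ f ⁻¹' V}, fun A hA => hA.1, ?_⟩
    refine Subset.antisymm (fun x hx => ?_) (sUnion_subset fun A hA => hA.2)
    obtain ⟨n, hn⟩ := exists_ball_label hq (hV.mem_nhds hx)
    obtain ⟨k, hk⟩ := mem_iUnion.1 ((hFU n).symm ▸ mem_univ x : x ∈ ⋃ k, F n k)
    refine ⟨B (n, k) (q n x), ⟨mem_iUnion.2 ⟨Nat.pair n k, q n x, ?_⟩, ?_⟩, hk, rfl⟩
    · rw [Nat.unpair_pair]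
    · rintro y ⟨-, hy⟩
      exact hn y hy

theorem FunctionallyFragmented.functionallyFSigmaMeasurable [T2Space X] [ParacompactSpace X]
    {f : X → Y} (hf : FunctionallyFragmented f) : FunctionallyFSigmaMeasurable f := by
  obtain ⟨q, F, hq, hF, hFq, hFU⟩ := hf.exists_labels
  intro V hV
  refine ⟨fun p => {x ∈ F p.unpair.1 p.unpair.2 | q p.unpair.1 x ∈
    {t | ∀ x', q p.unpair.1 x' = t → f x' ∈ V}}, fun p => ?_, ?_⟩
  · exact (hFq _ _).functionallyClosed (hF _ _) _
  · refine Subset.antisymm (fun x hx => ?_) (iUnion_subset fun p x hx => hx.2 x rfl)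
    obtain ⟨n, hn⟩ := exists_ball_label hq (hV.mem_nhds hx)
    obtain ⟨k, hk⟩ := mem_iUnion.1 ((hFU n).symm ▸ mem_univ x : x ∈ ⋃ k, F n k)
    refine mem_iUnion.2 ⟨Nat.pair n k, ?_⟩
    rw [Nat.unpair_pair]
    exact ⟨hk, hn⟩

end Base

/-! ### Countable sequences on Lindelöf spaces. -/

section Lindelof

variable {X : Type u} [TopologicalSpace X]

theorem LocConstOn.countable_image [LindelofSpace X] {T : Type*} {q : X → T} {F : Set X}
    (hq : LocConstOn q F) (hF : IsClosed F) : (q '' F).Countable := by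
  obtain ⟨t, ht, -, hcov⟩ := hF.isLindelof.elim_nhds_subcover
    (fun x => {x' | x' ∈ F → q x' = q x})
    (fun x hx => eventually_nhdsWithin_iff.1 (hq x hx))
  refine (ht.image q).mono ?_
  rintro _ ⟨x, hx, rfl⟩
  obtain ⟨y, hy, hxy⟩ := mem_iUnion₂.1 (hcov hx)
  exact ⟨y, hy, (hxy hx).symm⟩

theorem IsRegularSeq.countable_range_entry [T2Space X] [ParacompactSpace X] [LindelofSpace X]
    {α : Ordinal.{u}} {U : Ordinal.{u} → Set X} (hU : IsRegularSeq α U)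
    (hfo : ∀ ξ ≤ α, FunctionallyOpen (U ξ)) : (range (entry U)).Countable := by
  obtain ⟨F, hF, hFq, hFU⟩ := hU.exists_decomposition_univ hfo
  rw [← image_univ, ← hFU, image_iUnion]
  exact countable_iUnion fun n => (hFq n).countable_image (hF n).isClosed

/-- Repetitions in a regular sequence with countably many entry indices can be deleted, which
makes the sequence countable. -/
theorem IsAssociated.exists_countable {Y : Type v} [MetricSpace Y] {f : X → Y} {ε : ℝ}
    (hε : 0 < ε) {α : Ordinal.{u}} {U : Ordinal.{u} → Set X} (hU : IsAssociated f ε α U)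
    (hfo : ∀ ξ ≤ α, FunctionallyOpen (U ξ)) (hc : (range (entry U)).Countable) :
    ∃ (β : Ordinal.{u}) (V : Ordinal.{u} → Set X),
      β.card ≤ Cardinal.aleph0 ∧ IsAssociated f ε β V ∧ ∀ ξ ≤ β, FunctionallyOpen (V ξ) := by
  have : Countable (range (entry U)) := hc
  have : Small.{u} (range (entry U)) := inferInstance
  -- The new length is the order type of the set of occurring indices, so that set is replaced by a
  -- copy in the universe of X; s returns the old index and r the new rank.
  let T : Type u := Shrink.{u} (range (entry U))
  let e : range (entry U) ≃o T := orderIsoShrink _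
  have : Countable T := e.symm.injective.countable
  have : WellFoundedLT T := e.symm.toOrderEmbedding.wellFoundedLT
  let s : T → Ordinal.{u} := fun a => e.symm a
  let r : T → Ordinal.{u} := Ordinal.typein (α := T) (· < ·)
  have hr : ∀ {a b}, r a < r b ↔ a < b := Ordinal.typein_lt_typein _
  have hs : ∀ {a b}, s a < s b ↔ a < b := fun {a b} => e.symm.lt_iff_lt
  have hsurj : ∀ x, ∃ a, s a = entry U x := fun x =>
    ⟨e ⟨entry U x, x, rfl⟩, by simp [s]⟩
  have hsr : ∀ a, ∃ x, entry U x = s a := fun a => (e.symm a).2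
  have hsα : ∀ a, s a ≤ α := fun a => by
    obtain ⟨x, hx⟩ := hsr a
    exact hx ▸ hU.1.entry_le_top x
  -- The strict inequality makes V 0 empty, gives continuity at limits, and lets step η to η + 1 add
  -- exactly the points whose entry index has rank η.
  let V : Ordinal.{u} → Set X := fun η => ⋃ a : {a : T // r a < η}, U (s a)
  have hV : ∀ {η x}, x ∈ V η ↔ ∃ a, r a < η ∧ x ∈ U (s a) := by
    intro η x
    simp only [V, mem_iUnion, Subtype.exists, exists_prop]
  have hVo : ∀ η, FunctionallyOpen (V η) := fun η =>
    FunctionallyOpen.iUnion_of_countable fun a => hfo _ (hsα a)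
  refine ⟨Ordinal.type (α := T) (· < ·), V, ?_, ⟨⟨fun η _ => (hVo η).isOpen, ?_, ?_, ?_, ?_⟩, ?_⟩,
    fun η _ => hVo η⟩
  · rw [Ordinal.card_type]
    exact Cardinal.mk_le_aleph0
  · ext x
    simp [hV]
  · refine eq_univ_of_forall fun x => ?_
    obtain ⟨a, ha⟩ := hsurj x
    exact hV.2 ⟨a, Ordinal.typein_lt_type _ a, ha ▸ hU.1.mem_entry x⟩
  · intro ξ η h _ x hx
    obtain ⟨a, ha, hxa⟩ := hV.1 hx
    exact hV.2 ⟨a, ha.trans_le h, hxa⟩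
  · intro γ _ hγ
    ext x
    simp only [mem_iUnion, exists_prop, hV]
    constructor
    · rintro ⟨a, ha, hxa⟩
      exact ⟨Order.succ (r a), hγ.succ_lt ha, a, Order.lt_succ _, hxa⟩
    · rintro ⟨ξ, hξ, a, ha, hxa⟩
      exact ⟨a, ha.trans hξ, hxa⟩
  · intro η _
    have key : ∀ x ∈ V (Order.succ η) \ V η, ∃ a, r a = η ∧ entry U x = s a := by
      rintro x ⟨hx, hx'⟩
      obtain ⟨a, ha, hxa⟩ := hV.1 hx
      have haη : r a = η := le_antisymm (Order.lt_succ_iff.1 ha)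
        (not_lt.1 fun h => hx' (hV.2 ⟨a, h, hxa⟩))
      obtain ⟨b, hb⟩ := hsurj x
      refine ⟨a, haη, le_antisymm (entry_le hxa) (not_lt.1 fun h => ?_)⟩
      rw [← hb, hs, ← hr, haη] at h
      exact hx' (hV.2 ⟨b, h, hb ▸ hU.1.mem_entry x⟩)
    rcases eq_empty_or_nonempty (V (Order.succ η) \ V η) with h | ⟨x₀, hx₀⟩
    · rw [h]
      simpa using hε
    · obtain ⟨a, ha, hxa⟩ := key x₀ hx₀
      obtain ⟨ξ, hξ, hxξ⟩ := hU.1.exists_entry_eq_succ x₀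
      refine (Metric.ediam_mono (image_mono fun x hx => ?_)).trans_lt (hU.2 ξ hξ)
      obtain ⟨b, hb, hxb⟩ := key x hx
      have hab : b = a := Ordinal.typein_injective (α := T) (· < ·) (hb.trans ha.symm)
      have hx' : entry U x = Order.succ ξ := by rw [hxb, hab, ← hxa, hxξ]
      refine ⟨hx' ▸ hU.1.mem_entry x, fun hn => ?_⟩
      exact (Order.lt_succ ξ).not_ge (hx' ▸ entry_le hn)

theorem FunctionallyFragmented.countablyFunctionallyFragmented [T2Space X] [ParacompactSpace X]
    [LindelofSpace X] {Y : Type v} [MetricSpace Y] {f : X → Y} (hf : FunctionallyFragmented f) :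
    CountablyFunctionallyFragmented f := by
  intro ε hε
  obtain ⟨α, U, hU, hfo⟩ := hf ε hε
  exact hU.exists_countable hε hfo (hU.1.countable_range_entry hfo)

end Lindelof

/-! ### σ-locally constant approximations. -/

section Selection

variable {X : Type u} [TopologicalSpace X] {T : Type*}

/-- The space is the union of an increasing sequence of functionally closed sets on which `q` is
locally constant. -/
def SigmaLocConst (q : X → T) : Prop :=
  ∃ D : ℕ → Set X, Monotone D ∧ (∀ n, FunctionallyClosed (D n)) ∧ (∀ n, LocConstOn q (D n)) ∧
    ⋃ n, D n = univ

theorem sigmaLocConst_const (t : T) : SigmaLocConst fun _ : X => t :=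
  ⟨fun _ => univ, monotone_const, fun _ => functionallyClosed_univ,
    fun _ _ _ => Eventually.of_forall fun _ => rfl, iUnion_const _⟩

/-- Maps that are locally constant on the members of a countable functionally closed cover can be
glued along the first member that contains a given point. -/
theorem exists_sigmaLocConst {F : ℕ → Set X} {s : ℕ → X → T}
    (hF : ∀ k, FunctionallyClosed (F k)) (hs : ∀ k, LocConstOn (s k) (F k))
    (hFU : ⋃ k, F k = univ) : ∃ t : X → T, SigmaLocConst t ∧ ∀ x, ∃ k, x ∈ F k ∧ t x = s k x := by
  classical
  have hex : ∀ x, ∃ k, x ∈ F k := fun x => mem_iUnion.1 (hFU ▸ mem_univ x)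
  -- Exhausting the complement of the earlier members from inside makes the sets F k ∩ Z k N closed
  -- and pairwise disjoint in k, so finite unions preserve local constancy.
  choose Z hZm hZ hZU using fun k => (FunctionallyClosed.biUnion_lt hF k).compl.exists_monotone
  have hfirst : ∀ {k N x}, x ∈ F k ∩ Z k N → Nat.find (hex x) = k := by
    intro k N x hx
    refine (Nat.find_eq_iff _).2 ⟨hx.1, fun n hn hxn => ?_⟩
    have hx2 : x ∈ (⋃ n < k, F n)ᶜ := hZU k ▸ mem_iUnion.2 ⟨N, hx.2⟩
    exact hx2 (mem_iUnion₂.2 ⟨n, hn, hxn⟩)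
  refine ⟨fun x => s (Nat.find (hex x)) x, ⟨fun N => ⋃ k < N, F k ∩ Z k N, ?_, ?_, ?_, ?_⟩,
    fun x => ⟨_, Nat.find_spec (hex x), rfl⟩⟩
  · intro M N hMN x hx
    obtain ⟨k, hk, hx1, hx2⟩ := mem_iUnion₂.1 hx
    exact mem_iUnion₂.2 ⟨k, hk.trans_le hMN, hx1, hZm k hMN hx2⟩
  · exact fun N => FunctionallyClosed.biUnion_lt (fun k => (hF k).inter (hZ k N)) N
  · refine fun N => LocConstOn.biUnion_lt (fun k => ?_) (fun k => (hF k).inter (hZ k N)) ?_ N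
    · refine ((hs k).mono inter_subset_left).congr fun x hx => ?_
      rw [hfirst hx]
    · intro j k hjk
      exact disjoint_left.2 fun x hx hx' => hjk ((hfirst hx).symm.trans (hfirst hx'))
  · refine eq_univ_of_forall fun x => ?_
    have hx : x ∈ (⋃ n < Nat.find (hex x), F n)ᶜ := by
      intro h
      obtain ⟨n, hn, hxn⟩ := mem_iUnion₂.1 h
      exact Nat.find_min (hex x) hn hxn
    rw [← hZU] at hx
    obtain ⟨N, hN⟩ := mem_iUnion.1 hx
    refine mem_iUnion.2 ⟨max N (Nat.find (hex x) + 1), mem_iUnion₂.2 ⟨Nat.find (hex x), ?_,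
      Nat.find_spec (hex x), hZm _ (le_max_left _ _) hN⟩⟩
    exact (Nat.lt_succ_self _).trans_le (le_max_right _ _)

/-- Approximation of a functionally fragmented map `f` by a `σ`-locally constant map `s` with
prescribed neighborhoods `W`, compatible with a previous such map `r`. -/
theorem FunctionallyFragmented.exists_approx [T2Space X] [ParacompactSpace X] {Y : Type v}
    [MetricSpace Y] {f : X → Y} (hf : FunctionallyFragmented f) {r : X → Y}
    (hr : SigmaLocConst r) {O W : Y → Set Y} (hO : ∀ x, f x ∈ O (r x)) (hW : ∀ y, W y ∈ 𝓝 y) :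
    ∃ s : X → Y, SigmaLocConst s ∧ ∀ x, s x ∈ O (r x) ∧ f x ∈ W (s x) := by
  classical
  obtain ⟨q, F, hq, hF, hFq, hFU⟩ := hf.exists_labels
  obtain ⟨D, -, hD, hDr, hDU⟩ := hr
  obtain ⟨e, he⟩ := exists_surjective_nat (ℕ × ℕ × ℕ)
  let good : ℕ → Ordinal.{u} × Y → Y → Prop := fun m p z =>
    z ∈ O p.2 ∧ ∀ x, (q m x, r x) = p → f x ∈ W z
  -- The value depends on the label pair alone, hence is locally constant with it. The default is
  -- never used on the sets G i.
  let z : ℕ → Ordinal.{u} × Y → Y := fun m p => if h : ∃ z, good m p z then h.choose else p.2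
  have hz : ∀ {m p}, (∃ z, good m p z) → good m p (z m p) := by
    intro m p h
    simp only [z, dif_pos h]
    exact h.choose_spec
  have hl : ∀ m k N, LocConstOn (fun x => (q m x, r x)) (F m k ∩ D N) := fun m k N =>
    ((hFq m k).mono inter_subset_left).prodMk ((hDr N).mono inter_subset_right)
  let G : ℕ → Set X := fun i => {x ∈ F (e i).1 (e i).2.1 ∩ D (e i).2.2 |
    (q (e i).1 x, r x) ∈ {p | ∃ z, good (e i).1 p z}}
  have hG : ⋃ i, G i = univ := by
    refine eq_univ_of_forall fun x => ?_
    obtain ⟨m, hm⟩ := exists_ball_label hq (hW (f x))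
    obtain ⟨k, hk⟩ := mem_iUnion.1 ((hFU m).symm ▸ mem_univ x : x ∈ ⋃ k, F m k)
    obtain ⟨N, hN⟩ := mem_iUnion.1 (hDU.symm ▸ mem_univ x : x ∈ ⋃ N, D N)
    obtain ⟨i, hi⟩ := he (m, k, N)
    refine mem_iUnion.2 ⟨i, ?_⟩
    simp only [G, hi]
    -- For m large enough, f x itself is a good value for the label of x.
    exact ⟨⟨hk, hN⟩, f x, hO x, fun x' h => hm x' (Prod.mk.inj h).1⟩
  obtain ⟨s, hs, hsx⟩ := exists_sigmaLocConst (F := G)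
    (s := fun i x => z (e i).1 (q (e i).1 x, r x))
    (fun i => (hl _ _ _).functionallyClosed ((hF _ _).inter (hD _)) _)
    (fun i => ((hl _ _ _).mono (sep_subset _ _)).comp _) hG
  refine ⟨s, hs, fun x => ?_⟩
  obtain ⟨i, ⟨-, hi⟩, hsi⟩ := hsx x
  have := hz hi
  rw [hsi]
  exact ⟨this.1, this.2 x rfl⟩

end Selection

/-! ### Modifying continuous maps by means of adhesives. -/

section Extension

variable {X : Type u} [TopologicalSpace X] {Y : Type v}

theorem _root_.PartitionOfUnity.add_le_one {ι : Type*} {E : Set X} (φ : PartitionOfUnity ι X E)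
    {s t : ι} (hst : s ≠ t) (x : X) : φ s x + φ t x ≤ 1 := by
  classical
  refine le_trans ?_ (φ.sum_le_one x)
  have hfin := φ.locallyFinite.point_finite x
  rw [finsum_eq_sum_of_support_subset (s := hfin.toFinset ∪ {s, t}) _
    (fun i hi => Finset.mem_coe.2 (Finset.mem_union_left _ (hfin.mem_toFinset.2 hi))),
    ← Finset.sum_pair (f := fun i => φ i x) hst]
  exact Finset.sum_le_sum_of_subset_of_nonneg Finset.subset_union_right fun i _ _ => φ.nonneg i x

theorem _root_.PartitionOfUnity.eventually_forall_lt {ι : Type*} {E : Set X}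
    (φ : PartitionOfUnity ι X E) {a b : ℝ} (hab : a < b) (hb : 0 < b) {x : X}
    (hx : ∀ i, φ i x ≤ a) : ∀ᶠ y in 𝓝 x, ∀ i, φ i y < b := by
  obtain ⟨O, hO, hfin⟩ := φ.locallyFinite x
  have h : ∀ᶠ y in 𝓝 x, ∀ i ∈ {i | (Function.support (φ i) ∩ O).Nonempty}, φ i y < b :=
    (Filter.eventually_all_finite hfin).2 fun i _ =>
      (φ i).continuous.continuousAt.eventually_lt continuousAt_const ((hx i).trans_lt hab)
  filter_upwards [hO, h] with y hyO hy i
  by_cases hi : φ i y = 0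
  · rwa [hi]
  · exact hy i ⟨y, hi, hyO⟩

/-- A continuous map that is locally constant around a closed set `E` can be changed, within the
sets `V (g x)`, so that it takes prescribed locally constant values on `E`. -/
theorem exists_modification [T2Space X] [ParacompactSpace X] [TopologicalSpace Y] {U V : Y → Set Y}
    (hself : ∀ y, y ∈ V y)
    (hadh : ∀ y, ∀ z ∈ U y, ∀ A B : Set X, FunctionallyClosed A → FunctionallyClosed B →
      Disjoint A B → ∃ h : X → Y, Continuous h ∧ (∀ x, h x ∈ V y) ∧ (∀ x ∈ A, h x = y) ∧
        (∀ x ∈ B, h x = z))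
    {g : X → Y} (hg : Continuous g) {E : Set X} (hE : IsClosed E)
    (hloc : ∀ x ∈ E, ∀ᶠ x' in 𝓝 x, g x' = g x) {y : X → Y} (hy : LocConstOn y E)
    (hyU : ∀ x ∈ E, y x ∈ U (g x)) :
    ∃ g' : X → Y, Continuous g' ∧ (∀ x ∈ E, g' x = y x) ∧
      (∀ x ∈ E, ∀ᶠ x' in 𝓝 x, g' x' = g' x) ∧ ∀ x, g' x ∈ V (g x) := by
  classical
  let O : Y × Y → Set X := fun s => {x | ∀ᶠ x' in 𝓝 x, g x' = s.1 ∧ (x' ∈ E → y x' = s.2)}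
  have hcov : E ⊆ ⋃ s, O s := fun x hx => mem_iUnion.2 ⟨(g x, y x),
    (hloc x hx).and (eventually_nhdsWithin_iff.1 (hy x hx))⟩
  obtain ⟨φ, hφ⟩ := PartitionOfUnity.exists_isSubordinate hE O
    (fun s => isOpen_setOfPred_eventually_nhds) hcov
  have hO : ∀ {s x}, φ s x ≠ 0 → g x = s.1 ∧ (x ∈ E → y x = s.2) := by
    intro s x h
    have hx : x ∈ O s := hφ s (subset_closure h)
    exact Eventually.self_of_nhds (p := fun x' => g x' = s.1 ∧ (x' ∈ E → y x' = s.2)) hx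
  have hφ1 : ∀ x ∈ E, φ (g x, y x) x = 1 := by
    intro x hx
    rw [← φ.sum_eq_one hx]
    refine (finsum_eq_single (fun s => φ s x) _ fun s hs => ?_).symm
    by_contra hne
    exact hs (Prod.ext (hO hne).1.symm ((hO hne).2 hx).symm)
  -- Thresholds 1/2 < 2/3 < 3/4: above 1/2 the index s is unique, between 1/2 and 2/3 the map h s
  -- still equals g so the pieces glue, and from 3/4 on the new value is reached, hence around E.
  -- Pairs with s.2 ∉ U s.1 get a constant map; they are not the pairs attached to points of E.
  have hh : ∀ s : Y × Y, ∃ h : X → Y, Continuous h ∧ (∀ x, h x ∈ V s.1) ∧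
      (∀ x, φ s x ≤ 2 / 3 → h x = s.1) ∧ (s.2 ∈ U s.1 → ∀ x, 3 / 4 ≤ φ s x → h x = s.2) := by
    intro s
    by_cases hs : s.2 ∈ U s.1
    · obtain ⟨h, h1, h2, h3, h4⟩ := hadh s.1 s.2 hs {x | φ s x ≤ 2 / 3} {x | 3 / 4 ≤ φ s x}
        (functionallyClosed_le (φ s).continuous continuous_const)
        (functionallyClosed_le continuous_const (φ s).continuous)
        (disjoint_left.2 fun x hx hx' => by
          have h1 : φ s x ≤ 2 / 3 := hx
          have h2 : 3 / 4 ≤ φ s x := hx'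
          linarith)
      exact ⟨h, h1, h2, h3, fun _ => h4⟩
    · exact ⟨fun _ => s.1, continuous_const, fun _ => hself _, fun _ _ => rfl,
        fun h => absurd h hs⟩
  choose h hhc hhV hh0 hh1 using hh
  let g' : X → Y := fun x => if hx : ∃ s, 1 / 2 < φ s x then h hx.choose x else g x
  have hg'1 : ∀ {s x}, 1 / 2 < φ s x → g' x = h s x := by
    intro s x hx
    have hex : ∃ s, 1 / 2 < φ s x := ⟨s, hx⟩
    have heq : hex.choose = s := by
      by_contra hne
      have := φ.add_le_one hne x
      have := hex.choose_spec
      linarith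
    simp only [g', dif_pos hex, heq]
  have hg'0 : ∀ {x}, (∀ s, φ s x < 2 / 3) → g' x = g x := by
    intro x hx
    by_cases hex : ∃ s, 1 / 2 < φ s x
    · obtain ⟨s, hs⟩ := hex
      rw [hg'1 hs, hh0 s x (hx s).le]
      exact (hO (by linarith : (0 : ℝ) < φ s x).ne').1.symm
    · simp only [g', dif_neg hex]
  have hE' : ∀ x ∈ E, ∀ᶠ x' in 𝓝 x, g' x' = y x := by
    intro x hx
    have h1 := (φ (g x, y x)).continuous.continuousAt (x := x)
    have h2 : ∀ᶠ x' in 𝓝 x, 3 / 4 < φ (g x, y x) x' :=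
      continuousAt_const.eventually_lt h1 (by rw [hφ1 x hx]; norm_num)
    filter_upwards [h2] with x' hx'
    rw [hg'1 (by linarith : 1 / 2 < φ (g x, y x) x')]
    exact hh1 (g x, y x) (hyU x hx) x' hx'.le
  have hEx : ∀ x ∈ E, g' x = y x := fun x hx => (hE' x hx).self_of_nhds
  refine ⟨g', continuous_iff_continuousAt.2 fun x => ?_, hEx, fun x hx => ?_, fun x => ?_⟩
  · by_cases hex : ∃ s, 1 / 2 < φ s x
    · obtain ⟨s, hs⟩ := hex
      refine (hhc s).continuousAt.congr ?_
      filter_upwards [continuousAt_const.eventually_lt (φ s).continuous.continuousAt hs] with x' hx'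
      exact (hg'1 hx').symm
    · push Not at hex
      refine hg.continuousAt.congr ?_
      filter_upwards [φ.eventually_forall_lt (by norm_num : (1 / 2 : ℝ) < 2 / 3) (by norm_num)
        hex] with x' hx'
      exact (hg'0 hx').symm
  · rw [hEx x hx]
    exact hE' x hx
  · by_cases hex : ∃ s, 1 / 2 < φ s x
    · obtain ⟨s, hs⟩ := hex
      rw [hg'1 hs, (hO (by linarith : (0 : ℝ) < φ s x).ne').1]
      exact hhV s x
    · simp only [g', dif_neg hex]
      exact hself _

end Extension

/-! ### The Baire-one property. -/

section BaireOne

theorem exists_seq_of_step {A : Type*} {P : ℕ → A → Prop} {R : ℕ → A → A → Prop}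
    (h0 : ∃ a, P 0 a) (hs : ∀ n a, P n a → ∃ b, P (n + 1) b ∧ R n a b) :
    ∃ s : ℕ → A, ∀ n, P n (s n) ∧ R n (s n) (s (n + 1)) := by
  choose! b hb hR using hs
  obtain ⟨a, ha⟩ := h0
  have hP : ∀ n, P n (Nat.rec a (fun n c => b n c) n : A) := by
    intro n
    induction n with
    | zero => exact ha
    | succ n ih => exact hb n _ ih
  exact ⟨fun n => Nat.rec a (fun n c => b n c) n, fun n => ⟨hP n, hR n _ (hP n)⟩⟩

variable {X : Type u} {Y : Type v} [TopologicalSpace X] [MetricSpace Y]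

theorem FunctionallyFragmented.baireOne [T2Space X] [ParacompactSpace X] {f : X → Y}
    (hf : FunctionallyFragmented f) (hw : WeakAdhesive X Y) (hlw : LocallyWeakAdhesive X Y) :
    BaireOne f := by
  rcases isEmpty_or_nonempty X with hX | ⟨⟨x₀⟩⟩
  · exact ⟨fun _ => f, fun _ => continuous_of_discreteTopology, fun x => hX.elim x⟩
  choose U hU hUV hadh using fun (n : ℕ) (y : Y) =>
    hlw y (Metric.ball y ((1 / 2) ^ n)) (Metric.ball_mem_nhds y (by positivity))
  obtain ⟨y, hy⟩ := exists_seq_of_step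
    (P := fun n (s : X → Y) => SigmaLocConst s ∧ ∀ x, f x ∈ U n (s x))
    (R := fun n s s' => ∀ x, s' x ∈ U n (s x))
    (by
      obtain ⟨s, hs, h⟩ := hf.exists_approx (sigmaLocConst_const (f x₀)) (O := fun _ => univ)
        (W := U 0) (fun _ => mem_univ _) (hU 0)
      exact ⟨s, hs, fun x => (h x).2⟩)
    (fun n r ⟨hr, hfr⟩ => by
      obtain ⟨s, hs, h⟩ := hf.exists_approx hr hfr (hU (n + 1))
      exact ⟨s, ⟨hs, fun x => (h x).2⟩, fun x => (h x).1⟩)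
  choose D hDm hD hDy hDU using fun n => (hy n).1.1
  -- For fixed N these sets decrease in n, so local constancy of the map around the current set is
  -- inherited by the next; for fixed n, each point lies in them for all large N.
  let E : ℕ → ℕ → Set X := fun N n => ⋂ j ≤ n, D j N
  have hE : ∀ N n, IsClosed (E N n) := fun N n =>
    (FunctionallyClosed.biInter_le (fun j => hD j N) n).isClosed
  have hEy : ∀ N n, LocConstOn (y n) (E N n) := fun N n =>
    (hDy n N).mono (biInter_subset_of_mem (le_refl n))
  have hEE : ∀ N n, E N (n + 1) ⊆ E N n := fun N n x hx =>
    mem_iInter₂.2 fun j hj => mem_iInter₂.1 hx j (hj.trans n.le_succ)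
  have hG : ∀ N, ∃ g : ℕ → X → Y, ∀ n,
      (Continuous (g n) ∧ (∀ x ∈ E N n, g n x = y n x) ∧
        ∀ x ∈ E N n, ∀ᶠ x' in 𝓝 x, g n x' = g n x) ∧
      ∀ x, g (n + 1) x ∈ Metric.ball (g n x) ((1 / 2) ^ n) := by
    intro N
    refine exists_seq_of_step
      (P := fun n (g : X → Y) => Continuous g ∧ (∀ x ∈ E N n, g x = y n x) ∧
        ∀ x ∈ E N n, ∀ᶠ x' in 𝓝 x, g x' = g x)
      (R := fun n g g' => ∀ x, g' x ∈ Metric.ball (g x) ((1 / 2) ^ n)) ?_ ?_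
    -- The global weak adhesive property is needed only to start, from a constant map and without
    -- control on distances.
    · obtain ⟨g, h1, h2, h3, -⟩ := exists_modification (X := X) (U := fun _ : Y => univ)
        (V := fun _ => univ) (fun _ => mem_univ _)
        (fun a b _ A B hA hB hAB => by
          obtain ⟨h, h1, h2, h3⟩ := hw a b A B hA hB hAB
          exact ⟨h, h1, fun _ => mem_univ _, h2, h3⟩)
        (continuous_const (y := f x₀)) (hE N 0) (fun x _ => Eventually.of_forall fun _ => rfl)
        (hEy N 0) (fun _ _ => mem_univ _)
      exact ⟨g, h1, h2, h3⟩
    · rintro n g ⟨hg, hgy, hgl⟩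
      obtain ⟨g', h1, h2, h3, h4⟩ := exists_modification (U := U n)
        (V := fun a => Metric.ball a ((1 / 2) ^ n)) (fun a => Metric.mem_ball_self (by positivity))
        (hadh n) hg (hE N (n + 1)) (fun x hx => hgl x (hEE N n hx)) (hEy N (n + 1))
        (fun x hx => by
          rw [hgy x (hEE N n hx)]
          exact (hy n).2 x)
      exact ⟨g', ⟨h1, h2, h3⟩, h4⟩
  choose g hg using hG
  -- The bound is the geometric sum of (1/2)^j over n ≤ j < n + k.
  have hdist : ∀ N n k x, dist (g N (n + k) x) (g N n x) ≤
      2 * (1 / 2) ^ n - 2 * (1 / 2) ^ (n + k) := by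
    intro N n k x
    induction k with
    | zero => simp
    | succ k ih =>
      have h1 := (hg N (n + k)).2 x
      rw [Metric.mem_ball] at h1
      have h2 := dist_triangle (g N (n + (k + 1)) x) (g N (n + k) x) (g N n x)
      have h3 : ((1 : ℝ) / 2) ^ (n + (k + 1)) = (1 / 2) ^ (n + k) / 2 := by
        rw [← add_assoc, pow_succ]
        ring
      rw [← add_assoc] at h2 h3 ⊢
      rw [h3]
      linarith
  refine ⟨fun N => g N N, fun N => (hg N N).1.1, fun x => ?_⟩
  rw [Metric.tendsto_atTop]
  intro ε hε
  -- The final error is at most 2 · 2⁻ⁿ from g N N x to y n x plus 2⁻ⁿ from y n x to f x.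
  obtain ⟨n, hn⟩ := exists_pow_lt_of_lt_one (by positivity : 0 < ε / 3)
    (by norm_num : (1 / 2 : ℝ) < 1)
  have hxE : ∃ N₀, ∀ N ≥ N₀, x ∈ E N n := by
    have hxD : ∀ j, ∃ N, x ∈ D j N := fun j =>
      mem_iUnion.1 ((hDU j).symm ▸ mem_univ x : x ∈ ⋃ N, D j N)
    choose M hM using hxD
    refine ⟨(Finset.range (n + 1)).sup M, fun N hN => mem_iInter₂.2 fun j hj => ?_⟩
    refine hDm j (le_trans (Finset.le_sup (f := M) ?_) hN) (hM j)
    simpa using Nat.lt_succ_of_le hj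
  obtain ⟨N₀, hN₀⟩ := hxE
  refine ⟨max N₀ n, fun N hN => ?_⟩
  obtain ⟨k, rfl⟩ := Nat.exists_eq_add_of_le ((le_max_right _ _).trans hN)
  have h1 := hdist (n + k) n k x
  rw [(hg (n + k) n).1.2.1 x (hN₀ _ ((le_max_left _ _).trans hN))] at h1
  have h2 := hUV n (y n x) ((hy n).1.2 x)
  rw [Metric.mem_ball] at h2
  have h3 := dist_triangle_right (g (n + k) (n + k) x) (f x) (y n x)
  have h4 : (0 : ℝ) < (1 / 2) ^ (n + k) := by positivity
  linarith

end BaireOne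

end Frag

theorem theorem1 {X : Type u} {Y : Type v} [TopologicalSpace X] [T2Space X] [ParacompactSpace X]
    [MetricSpace Y] (f : X → Y) (hf : Frag.FunctionallyFragmented f) :
    (Frag.SigmaDiscrete f ∧ Frag.FunctionallyFSigmaMeasurable f) ∧
    (Frag.WeakAdhesive X Y → Frag.LocallyWeakAdhesive X Y → Frag.BaireOne f) ∧
    (LindelofSpace X → Frag.CountablyFunctionallyFragmented f) := by
  refine ⟨⟨hf.sigmaDiscrete, hf.functionallyFSigmaMeasurable⟩, fun hw hlw => hf.baireOne hw hlw,
    fun _ => hf.countablyFunctionallyFragmented⟩
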